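/- **Setting.** Let $X$ be a closed subset of a separable real Banach space with the induced metric $d_X$, $Y$ a complete separable metric space, and $\mathcal H$ a separable real Hilbert space. Let $F\colon X\rightsquigarrow Y$ be a set-valued map with non-empty images and closed graph $Z=\{(x,y)\in X\times Y : y\in F(x)\}$, and write $Z_x=F(x)$. Let $g\colon Z\to\mathcal H$ and $f\colon\mathcal H\to\mathbb R$. Let $\mathcal P^1(X)$ be the set of Borel probability measures $m$ on $X$ with $\int_X d_X(x,x_0)\,dm(x)<\infty$ for some $x_0\in X$. For a Borel probability measure $m$ on $X$, let $\mathcal P_m(Z)$ be the set of Borel probability measures on $Z$ whose marginal on $X$ is $m$, and put $$G_m=\Big\{\int_Z g\,d\mu : \mu\in\mathcal P_m(Z)\Big\},\qquad V(m)=\inf_{\mu\in\mathcal P_m(Z)} f\Big(\int_Z g\,d\mu\Big).$$ For $\lambda\in\mathcal H$ put $g_\lambda=\langle\lambda,g\rangle$ and $u_\lambda(x)=\inf_{y\in Z_x} g_\lambda(x,y)$. Let $f^*(\lambda)=\sup_{\beta\in\mathcal H}\big(\langle\lambda,\beta\rangle-f(\beta)\big)$ and $\operatorname{dom}(f^*)=\{\lambda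 : f^*(\lambda)<+\infty\}$. **Assumptions.** 1. $g$ is bounded; $f$ is convex and differentiable, and $\nabla f$ is Lipschitz continuous. 2. For every $\lambda\in\operatorname{dom}(f^*)$: $g_\lambda$ is lower semicontinuous on $Z$; the set-valued map $x\mapsto\{g_\lambda(x,y) : y\in Z_x\}$ is lower semicontinuous; and $\operatorname{argmin}_{y\in Z_x} g_\lambda(x,y)\neq\emptyset$ for every $x\in X$. 3. $g$ is continuous; $Z_x$ is compact for every $x\in X$, and $F$ is upper semicontinuous. 4. There is $L_g\ge 0$ such that for all $x_1,x_2\in X$ and $y_1\in Z_{x_1}$ there is $y_2\in Z_{x_2}$ with $\|g(x_1,y_1)-g(x_2,y_2)\|\le L_g\, d_X(x_1,x_2)$. 5. $G_m$ is closed in $\mathcal H$ for every $m\in\mathcal P^1(X)$. **Conclusion.** For every $m\in\mathcal P^1(X)$, the infimum $V(m)$ is finite (taken over a non-empty set of costs that is bounded below), and the dual objective $\mathcal D_m(\lambda)=f^*(\lambda)-\int_X u_\lambda\,dm$ has a unique minimizer $\lambda^*(m)$ over $\operatorname{dom}(f^*)$. Put $v(m,x)=u_{\lambda^*(m)}(x)$;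 for every $m\in\mathcal P^1(X)$, the function $v(m,\cdot)$ is integrable with respect to every measure in $\mathcal P^1(X)$. For all $m_0,m_1\in\mathcal P^1(X)$, $$\lim_{t\to0^+}\frac{V(m_0+t(m_1-m_0))-V(m_0)}{t}=\int_X v(m_0,x)\,d(m_1-m_0)(x).$$ Moreover, $t\mapsto\int_X v(m_0+t(m_1-m_0),x)\,d(m_1-m_0)(x)$ is integrable on $[0,1]$, and $$V(m_1)-V(m_0)=\int_0^1\int_X v(m_0+t(m_1-m_0),x)\,d(m_1-m_0)(x)\,dt.$$ -/

import Mathlib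

open MeasureTheory Filter Topology
open scoped NNReal ENNReal Pointwise

namespace MFO

noncomputable section

variable {X Y H : Type*}

/-- The graph `Z` of a set-valued map `F : X ⇝ Y`; its fibre over `x` is `Z_x = F x`. -/
abbrev Graph (F : X → Set Y) : Set (X × Y) := {p | p.2 ∈ F p.1}

/-- The point `(x, y)` of the graph. -/
abbrev Graph.mk {F : X → Set Y} (x : X) (y : Y) (hy : y ∈ F x) : Graph F := ⟨(x, y), hy⟩

section Measures

variable [MeasurableSpace X] [MeasurableSpace Y]

/-- Borel probability measures on `X` with finite first moment. -/
def P1 (X : Type*) [MetricSpace X] [MeasurableSpace X] : Set (Measure X) :=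
  {m | IsProbabilityMeasure m ∧ ∃ x₀ : X, ∫⁻ x, edist x x₀ ∂m < ∞}

/-- `m₀ + t (m₁ - m₀)`, written as `(1 - t) m₀ + t m₁`; only used for `t ∈ [0, 1]`. -/
def segment (m₀ m₁ : Measure X) (t : ℝ) : Measure X :=
  ENNReal.ofReal (1 - t) • m₀ + ENNReal.ofReal t • m₁

/-- `∫ φ d(m₁ - m₀)`. -/
def integralDiff (φ : X → ℝ) (m₀ m₁ : Measure X) : ℝ :=
  ∫ x, φ x ∂m₁ - ∫ x, φ x ∂m₀

/-- `𝒫_m(Z)`: the probability measures on `Z` whose first marginal is `m`. -/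
def admissible (F : X → Set Y) (m : Measure X) : Set (Measure (Graph F)) :=
  {μ | IsProbabilityMeasure μ ∧ μ.map (fun z : Graph F => z.1.1) = m}

variable [NormedAddCommGroup H] [InnerProductSpace ℝ H]

/-- `G_m`: all the aggregates `∫_Z g dμ`, `μ ∈ 𝒫_m(Z)`. -/
def aggregates {F : X → Set Y} (g : Graph F → H) (m : Measure X) : Set H :=
  (fun μ : Measure (Graph F) => ∫ z, g z ∂μ) '' admissible F m

/-- All the costs `f (∫_Z g dμ)`, `μ ∈ 𝒫_m(Z)`. -/
def costs {F : X → Set Y} (f : H → ℝ) (g : Graph F → H) (m : Measure X) : Set ℝ :=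
  (fun μ : Measure (Graph F) => f (∫ z, g z ∂μ)) '' admissible F m

/-- The value function `V(m) = inf_{μ ∈ 𝒫_m(Z)} f (∫_Z g dμ)`. -/
def V {F : X → Set Y} (f : H → ℝ) (g : Graph F → H) (m : Measure X) : ℝ :=
  sInf (costs f g m)

end Measures

variable [NormedAddCommGroup H] [InnerProductSpace ℝ H]

/-- `g_λ(x, y) = ⟨λ, g(x, y)⟩`. -/
def gLam {F : X → Set Y} (g : Graph F → H) (lam : H) (z : Graph F) : ℝ :=
  inner ℝ lam (g z)

/-- `u_λ(x) = inf_{y ∈ Z_x} g_λ(x, y)`. -/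
def u {F : X → Set Y} (g : Graph F → H) (lam : H) (x : X) : ℝ :=
  ⨅ y : F x, gLam g lam (Graph.mk x y.1 y.2)

/-- `G_λ(x) = {g_λ(x, y) : y ∈ Z_x}`. -/
def GLam {F : X → Set Y} (g : Graph F → H) (lam : H) (x : X) : Set ℝ :=
  Set.range fun y : F x => gLam g lam (Graph.mk x y.1 y.2)

/-- `BR_λ(x) = argmin_{y ∈ Z_x} g_λ(x, y)`. -/
def BR {F : X → Set Y} (g : Graph F → H) (lam : H) (x : X) : Set Y :=
  {y | ∃ hy : y ∈ F x, ∀ (y' : Y) (hy' : y' ∈ F x),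
    gLam g lam (Graph.mk x y hy) ≤ gLam g lam (Graph.mk x y' hy')}

/-- `x ↦ {g(x, y) : y ∈ Z_x}`. -/
def gImage {F : X → Set Y} (g : Graph F → H) (x : X) : Set H :=
  Set.range fun y : F x => g (Graph.mk x y.1 y.2)

/-- The set-valued map `S` is `K`-Lipschitz: `S x₁ ⊆ S x₂ + B(0, K d(x₁, x₂))` (closed balls). -/
def LipschitzSetValued [MetricSpace X] (K : ℝ≥0) (S : X → Set H) : Prop :=
  ∀ x₁ x₂ : X, S x₁ ⊆ S x₂ + Metric.closedBall (0 : H) (K * dist x₁ x₂)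

/-- The Fenchel conjugate `f*(λ) = sup_β (⟨λ, β⟩ - f(β))`. -/
def fenchelConj (f : H → ℝ) (lam : H) : EReal :=
  ⨆ β : H, ((inner ℝ lam β - f β : ℝ) : EReal)

/-- The domain of the Fenchel conjugate. -/
def domConj (f : H → ℝ) : Set H := {lam | fenchelConj f lam < ⊤}

/-- The dual objective `𝒟_m(λ) = f*(λ) - ∫ u_λ dm`. -/
def dualObj [MeasurableSpace X] {F : X → Set Y} (f : H → ℝ) (g : Graph F → H) (m : Measure X)
    (lam : H) : EReal :=
  fenchelConj f lam - ((∫ x, u g lam x ∂m : ℝ) : EReal)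

/-- `λ` minimizes `𝒟_m` over `dom f*`. -/
def IsDualSolution [MeasurableSpace X] {F : X → Set Y} (f : H → ℝ) (g : Graph F → H)
    (m : Measure X) (lam : H) : Prop :=
  lam ∈ domConj f ∧ IsMinOn (dualObj f g m) (domConj f) lam

/-- `λ*(m)`, the dual solution. -/
def dualSolution [MeasurableSpace X] {F : X → Set Y} (f : H → ℝ) (g : Graph F → H)
    (m : Measure X) : H :=
  Classical.epsilon (IsDualSolution f g m)

/-- `v(m, x) = u_{λ*(m)}(x)`. -/
def v [MeasurableSpace X] {F : X → Set Y} (f : H → ℝ) (g : Graph F → H)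
    (m : Measure X) (x : X) : ℝ :=
  u g (dualSolution f g m) x

/-- The assumptions on `f` and `g` under which the dual problem is considered. -/
structure DualityAssumption [TopologicalSpace X] [TopologicalSpace Y] [CompleteSpace H]
    {F : X → Set Y} (f : H → ℝ) (g : Graph F → H) (L : ℝ≥0) : Prop where
  bounded_g : ∃ M : ℝ, ∀ z, ‖g z‖ ≤ M
  convex_f : ConvexOn ℝ Set.univ f
  differentiable_f : Differentiable ℝ f
  lipschitz_gradient : LipschitzWith L (gradient f)
  lsc_gLam : ∀ lam ∈ domConj f, LowerSemicontinuous (gLam g lam)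
  lsc_GLam : ∀ lam ∈ domConj f, LowerHemicontinuous (GLam g lam)
  nonempty_BR : ∀ lam ∈ domConj f, ∀ x, (BR g lam x).Nonempty

/-- The regularity assumptions on `F` and `g` used for the stability with respect to `m`. -/
structure StabilityAssumption [MetricSpace X] [TopologicalSpace Y]
    (F : X → Set Y) (g : Graph F → H) (Lg : ℝ≥0) : Prop where
  continuous_g : Continuous g
  compact_fibres : ∀ x, IsCompact (F x)
  usc_F : UpperHemicontinuous F
  lipschitz_gImage : LipschitzSetValued Lg (gImage g)

end

end MFO

/-! The dual solution is $\lambda^*(m)=\nabla f(\beta)$, where $\beta$ minimizes $f$ over the closed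
bounded convex set $G_m$. Indeed the first-order condition says that $\beta$ minimizes
$\langle\nabla f(\beta),\cdot\rangle$ over $G_m$, and a measurable selection of best responses shows
that the minimum of $\langle\lambda,\cdot\rangle$ over $G_m$ is $\int u_\lambda\,dm$. Hence there is
no duality gap, and every dual solution is a subgradient of $f$ at $\beta$, so it is $\nabla
f(\beta)$ (`exists_optimal_aggregate`).

Along $m_t=m_0+t(m_1-m_0)$, let $\lambda_t=\lambda^*(m_t)$ and $p(t)=\int
u_{\lambda_t}\,d(m_1-m_0)$. The gradient inequality at the optimal aggregates makes $p(t)$ a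
subgradient of $t\mapsto V(m_t)$. Its quantitative form `add_inner_gradient_add_norm_sq_le` adds a
multiple of $\|\lambda_s-\lambda_t\|^2$, which makes $\lambda_t$, and then $p$, Lipschitz in $t$. A
continuous selection of subgradients is a derivative, and the fundamental theorem of calculus
concludes. -/

namespace MFO

/-! ### Convex analysis in a Hilbert space. -/

section Convex

variable {H : Type*} [NormedAddCommGroup H] [InnerProductSpace ℝ H] [CompleteSpace H]

theorem tendsto_slope_inner_gradient {f : H → ℝ} (hf : Differentiable ℝ f) (x d : H) :
    Tendsto (fun t : ℝ => t⁻¹ * (f (x + t • d) - f x)) (𝓝[>] 0)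
      (𝓝 (inner ℝ (gradient f x) d)) := by
  have h1 : HasDerivAt (fun t : ℝ => x + t • d) d 0 := by
    simpa using ((hasDerivAt_id (0 : ℝ)).smul_const d).const_add x
  have h2 : HasFDerivAt f (InnerProductSpace.toDual ℝ H (gradient f x)) (x + (0 : ℝ) • d) := by
    simpa using (hf x).hasGradientAt.hasFDerivAt
  have h3 := h2.comp_hasDerivAt (0 : ℝ) h1
  simpa [InnerProductSpace.toDual_apply_apply] using h3.tendsto_slope_zero_right

theorem le_inner_gradient {f : H → ℝ} (hf : Differentiable ℝ f) {x d : H} {c : ℝ}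
    (h : ∀ t ∈ Set.Ioo (0 : ℝ) 1, c * t ≤ f (x + t • d) - f x) :
    c ≤ inner ℝ (gradient f x) d := by
  refine ge_of_tendsto (tendsto_slope_inner_gradient hf x d) ?_
  filter_upwards [Ioo_mem_nhdsGT (zero_lt_one' ℝ)] with t ht
  rw [inv_mul_eq_div, le_div_iff₀ ht.1]
  exact h t ht

theorem inner_gradient_le {f : H → ℝ} (hf : Differentiable ℝ f) {x d : H} {c : ℝ}
    (h : ∀ t ∈ Set.Ioo (0 : ℝ) 1, f (x + t • d) - f x ≤ c * t) :
    inner ℝ (gradient f x) d ≤ c := by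
  refine le_of_tendsto (tendsto_slope_inner_gradient hf x d) ?_
  filter_upwards [Ioo_mem_nhdsGT (zero_lt_one' ℝ)] with t ht
  rw [inv_mul_eq_div, div_le_iff₀ ht.1]
  exact h t ht

theorem add_inner_gradient_le {f : H → ℝ} (hc : ConvexOn ℝ Set.univ f)
    (hf : Differentiable ℝ f) (x y : H) :
    f x + inner ℝ (gradient f x) (y - x) ≤ f y := by
  have := inner_gradient_le hf (x := x) (d := y - x) (c := f y - f x) fun t ht => by
    have h := hc.2 (Set.mem_univ x) (Set.mem_univ y) (sub_nonneg.2 ht.2.le) ht.1.le (by ring)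
    have e : (1 - t) • x + t • y = x + t • (y - x) := by module
    rw [e] at h
    simp only [smul_eq_mul] at h
    linarith
  linarith

/-- A subgradient of a differentiable function is its gradient. -/
theorem eq_gradient_of_subgradient {f : H → ℝ} (hf : Differentiable ℝ f) {x lam : H}
    (h : ∀ y, f x + inner ℝ lam (y - x) ≤ f y) : lam = gradient f x := by
  have h1 := le_inner_gradient hf (x := x) (d := lam - gradient f x)
    (c := inner ℝ lam (lam - gradient f x)) fun t _ => by
      have := h (x + t • (lam - gradient f x))
      rw [add_sub_cancel_left, inner_smul_right] at this
      linarith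
  have h2 : inner ℝ (lam - gradient f x) (lam - gradient f x) ≤ 0 := by
    rw [inner_sub_left]; linarith
  rw [real_inner_self_eq_norm_sq] at h2
  exact sub_eq_zero.1 (norm_eq_zero.1
    ((pow_eq_zero_iff two_ne_zero).1 (le_antisymm h2 (sq_nonneg _))))

/-- Quantitative form of the gradient inequality when the gradient is Lipschitz continuous. -/
theorem add_inner_gradient_add_norm_sq_le {f : H → ℝ} (hc : ConvexOn ℝ Set.univ f)
    (hf : Differentiable ℝ f) {K : ℝ} (hK : 0 < K)
    (hl : ∀ x y, ‖gradient f x - gradient f y‖ ≤ K * ‖x - y‖) (x y : H) :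
    f x + inner ℝ (gradient f x) (y - x) + (4 * K)⁻¹ * ‖gradient f y - gradient f x‖ ^ 2
      ≤ f y := by
  set w : H := gradient f y - gradient f x with hw
  -- The gradient inequalities from `x` to `z` and from `z` to `y` leave a surplus of at least `(r -
  -- K * r ^ 2) * ‖w‖ ^ 2`; this `r` maximizes it.
  set r : ℝ := (2 * K)⁻¹ with hr
  set z : H := y - r • w with hz
  have hr0 : 0 < r := by positivity
  have h1 := add_inner_gradient_le hc hf x z
  have h2 := add_inner_gradient_le hc hf z y
  have h3 : inner ℝ (gradient f y - gradient f z) (y - z) ≤ K * ‖y - z‖ * ‖y - z‖ :=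
    (real_inner_le_norm _ _).trans (mul_le_mul_of_nonneg_right (hl y z) (norm_nonneg _))
  have hyz : y - z = r • w := by rw [hz]; abel
  have hzx : z - x = (y - x) - r • w := by rw [hz]; abel
  have hn : ‖y - z‖ = r * ‖w‖ := by rw [hyz, norm_smul, Real.norm_of_nonneg hr0.le]
  rw [hn, hyz, inner_sub_left, inner_smul_right, inner_smul_right] at h3
  rw [hyz, inner_smul_right] at h2
  rw [hzx, inner_sub_right, inner_smul_right] at h1
  have h4 : inner ℝ (gradient f y) w - inner ℝ (gradient f x) w = ‖w‖ ^ 2 := by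
    rw [← inner_sub_left, ← hw, real_inner_self_eq_norm_sq]
  have h5 : r * ‖w‖ ^ 2 - K * (r * ‖w‖) * (r * ‖w‖) = (4 * K)⁻¹ * ‖w‖ ^ 2 := by
    rw [hr]; field_simp; ring
  rw [← h5]
  have h6 : r * inner ℝ (gradient f y) w - r * inner ℝ (gradient f x) w = r * ‖w‖ ^ 2 := by
    rw [← h4]; ring
  linarith

/-- A decreasing sequence of non-empty bounded closed convex sets has a common point. -/
theorem exists_mem_forall_of_antitone_convex {C : ℕ → Set H} (hanti : Antitone C)
    (hne : ∀ n, (C n).Nonempty) (hcl : ∀ n, IsClosed (C n)) (hconv : ∀ n, Convex ℝ (C n))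
    {M : ℝ} (hM : ∀ x ∈ C 0, ‖x‖ ≤ M) : ∃ x, ∀ n, x ∈ C n := by
  -- The points of least norm form a Cauchy sequence, which replaces weak compactness.
  have hex : ∀ n, ∃ p ∈ C n, ∀ q ∈ C n, ‖p‖ ≤ ‖q‖ := fun n => by
    obtain ⟨p, hp, hpe⟩ :=
      exists_norm_eq_iInf_of_complete_convex (hne n) (hcl n).isComplete (hconv n) 0
    refine ⟨p, hp, fun q hq => ?_⟩
    have : ‖0 - p‖ ≤ ‖0 - q‖ := by
      rw [hpe]
      exact ciInf_le (f := fun w : C n => ‖0 - (w : H)‖)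
        ⟨0, by rintro _ ⟨w, rfl⟩; exact norm_nonneg _⟩ ⟨q, hq⟩
    simpa using this
  choose p hp hmin using hex
  have hmono : Monotone fun n => ‖p n‖ ^ 2 := fun i j hij =>
    pow_le_pow_left₀ (norm_nonneg _) (hmin i _ (hanti hij (hp j))) 2
  have hbdd : BddAbove (Set.range fun n => ‖p n‖ ^ 2) := by
    refine ⟨M ^ 2, ?_⟩
    rintro _ ⟨n, rfl⟩
    exact pow_le_pow_left₀ (norm_nonneg _) (hM _ (hanti (Nat.zero_le n) (hp n))) 2
  have hlim := tendsto_atTop_ciSup hmono hbdd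
  set ℓ := ⨆ n, ‖p n‖ ^ 2
  have hle : ∀ n, ‖p n‖ ^ 2 ≤ ℓ := fun n => le_ciSup hbdd n
  -- The midpoint lies in `C i`, so its norm is at least `‖p i‖`; the parallelogram law does the
  -- rest, even with 2 in place of 4.
  have hdist : ∀ i j, i ≤ j → ‖p i - p j‖ ^ 2 ≤ 4 * (ℓ - ‖p i‖ ^ 2) := fun i j hij => by
    have hmid : (2⁻¹ : ℝ) • p i + (2⁻¹ : ℝ) • p j ∈ C i :=
      hconv i (hp i) (hanti hij (hp j)) (by norm_num) (by norm_num) (by norm_num)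
    have h1 := hmin i _ hmid
    rw [← smul_add, norm_smul, Real.norm_of_nonneg (by norm_num)] at h1
    have h2 : ‖p i‖ ^ 2 ≤ (2⁻¹ * ‖p i + p j‖) ^ 2 := pow_le_pow_left₀ (norm_nonneg _) h1 2
    have h3 := parallelogram_law_with_norm ℝ (p i) (p j)
    have h4 := hle j
    nlinarith
  have hcau : CauchySeq p := by
    refine cauchySeq_of_le_tendsto_0 (fun n => 2 * √(4 * (ℓ - ‖p n‖ ^ 2))) ?_ ?_
    · intro i j N hi hj
      have hb : ∀ k, N ≤ k → dist (p N) (p k) ≤ √(4 * (ℓ - ‖p N‖ ^ 2)) := fun k hk => by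
        rw [dist_eq_norm]
        exact Real.le_sqrt_of_sq_le (hdist N k hk)
      have := dist_triangle_left (p i) (p j) (p N)
      have := hb i hi
      have := hb j hj
      linarith
    · have : Tendsto (fun n => 2 * √(4 * (ℓ - ‖p n‖ ^ 2))) atTop (𝓝 (2 * √(4 * (ℓ - ℓ)))) :=
        ((hlim.const_sub ℓ).const_mul 4).sqrt.const_mul 2
      simpa using this
  obtain ⟨x, hx⟩ := cauchySeq_tendsto_of_complete hcau
  refine ⟨x, fun n => (hcl n).mem_of_tendsto hx ?_⟩
  filter_upwards [eventually_ge_atTop n] with k hk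
  exact hanti hk (hp k)

/-- A continuous convex function that is bounded below attains its minimum on a bounded closed
convex set. -/
theorem exists_isMinOn_of_convex {f : H → ℝ} (hc : ConvexOn ℝ Set.univ f) (hf : Continuous f)
    {G : Set H} (hne : G.Nonempty) (hcl : IsClosed G) (hconv : Convex ℝ G)
    {M : ℝ} (hM : ∀ x ∈ G, ‖x‖ ≤ M) (hbdd : BddBelow (f '' G)) : ∃ x ∈ G, IsMinOn f G x := by
  set a := sInf (f '' G)
  let C : ℕ → Set H := fun n => G ∩ {x | f x ≤ a + 1 / ((n : ℝ) + 1)}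
  obtain ⟨x, hx⟩ := exists_mem_forall_of_antitone_convex (C := C) (M := M)
    (fun i j hij x hx => ⟨hx.1, le_trans (hx.2 : f x ≤ a + 1 / ((j : ℝ) + 1))
      (add_le_add_right (Nat.one_div_le_one_div hij) a)⟩)
    (fun n => by
      obtain ⟨_, ⟨x, hx, rfl⟩, h⟩ := Real.lt_sInf_add_pos (hne.image f)
        (Nat.one_div_pos_of_nat (α := ℝ) (n := n))
      exact ⟨x, hx, h.le⟩)
    (fun n => hcl.inter (isClosed_le hf continuous_const))
    (fun n => hconv.inter (by simpa using hc.convex_le (a + 1 / ((n : ℝ) + 1))))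
    (fun x hx => hM x hx.1)
  refine ⟨x, (hx 0).1, fun y hy => ?_⟩
  have hxa : f x ≤ a := by
    refine ge_of_tendsto (f := fun n : ℕ => a + 1 / ((n : ℝ) + 1)) (x := atTop) ?_
      (Eventually.of_forall fun n => (hx n).2)
    simpa using tendsto_one_div_add_atTop_nhds_zero_nat.const_add a
  exact hxa.trans (csInf_le hbdd ⟨y, hy, rfl⟩)

end Convex

/-! ### Measurable selections. -/

section Selection

variable {X Y : Type*} [MeasurableSpace X] [MetricSpace Y]

/-- Measurable set-valued maps with non-empty closed values. -/
structure MeasurableClosedValued (S : X → Set Y) : Prop where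
  nonempty : ∀ x, (S x).Nonempty
  isClosed : ∀ x, IsClosed (S x)
  measurable : ∀ C, IsClosed C → MeasurableSet {x | (S x ∩ C).Nonempty}

/-- One step of the selection theorem: cut `S x` with the first `ε`-ball around a dense sequence
that meets it. With closed balls, the values stay closed, and testing against `C` amounts to testing
`S` against closed sets. -/
theorem MeasurableClosedValued.exists_refinement [TopologicalSpace.SeparableSpace Y] [Nonempty Y]
    [MeasurableSpace Y] {S : X → Set Y} (hS : MeasurableClosedValued S) {ε : ℝ} (hε : 0 < ε) :
    ∃ (S' : X → Set Y) (c : X → Y), MeasurableClosedValued S' ∧ Measurable c ∧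
      ∀ x, S' x ⊆ S x ∧ S' x ⊆ Metric.closedBall (c x) ε := by
  classical
  let d := TopologicalSpace.denseSeq Y
  have hex : ∀ x, ∃ n, (S x ∩ Metric.closedBall (d n) ε).Nonempty := fun x => by
    obtain ⟨y, hy⟩ := hS.nonempty x
    obtain ⟨n, hn⟩ := (TopologicalSpace.denseRange_denseSeq Y).exists_dist_lt y hε
    exact ⟨n, y, hy, hn.le⟩
  let k : X → ℕ := fun x => Nat.find (hex x)
  have hk : Measurable k := measurable_find hex fun n => hS.measurable _ Metric.isClosed_closedBall
  refine ⟨fun x => S x ∩ Metric.closedBall (d (k x)) ε, fun x => d (k x),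
    ⟨fun x => Nat.find_spec (hex x), fun x => (hS.isClosed x).inter Metric.isClosed_closedBall,
      fun C hC => ?_⟩, measurable_from_nat.comp hk,
    fun x => ⟨Set.inter_subset_left, Set.inter_subset_right⟩⟩
  have : {x | (S x ∩ Metric.closedBall (d (k x)) ε ∩ C).Nonempty} =
      ⋃ n, k ⁻¹' {n} ∩ {x | (S x ∩ (Metric.closedBall (d n) ε ∩ C)).Nonempty} := by
    ext x
    simp [Set.inter_assoc]
  rw [this]
  exact MeasurableSet.iUnion fun n => (hk (measurableSet_singleton n)).inter
    (hS.measurable _ (Metric.isClosed_closedBall.inter hC))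

/-- The Kuratowski–Ryll-Nardzewski selection theorem, for maps that are measurable in the sense
that the inverse images of closed sets are measurable. -/
theorem MeasurableClosedValued.exists_measurable_selection [CompleteSpace Y]
    [TopologicalSpace.SeparableSpace Y] [MeasurableSpace Y] [BorelSpace Y]
    {S : X → Set Y} (hS : MeasurableClosedValued S) :
    ∃ s : X → Y, Measurable s ∧ ∀ x, s x ∈ S x := by
  rcases isEmpty_or_nonempty X with hX | ⟨⟨x₀⟩⟩
  · exact ⟨fun x => isEmptyElim x, measurable_of_empty _, fun x => isEmptyElim x⟩
  have : Nonempty Y := (hS.nonempty x₀).to_type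
  have hstep : ∀ (n : ℕ) (T : {T : X → Set Y // MeasurableClosedValued T}),
      ∃ (T' : {T : X → Set Y // MeasurableClosedValued T}) (c : X → Y), Measurable c ∧
        ∀ x, T'.1 x ⊆ T.1 x ∧ T'.1 x ⊆ Metric.closedBall (c x) ((1 / 2 : ℝ) ^ n) := fun n T => by
    obtain ⟨T', c, h1, h2, h3⟩ := T.2.exists_refinement (ε := (1 / 2 : ℝ) ^ n) (by positivity)
    exact ⟨⟨T', h1⟩, c, h2, h3⟩
  choose next c hc hnext using hstep
  let T : ℕ → {T : X → Set Y // MeasurableClosedValued T} := fun n =>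
    Nat.rec ⟨S, hS⟩ next n
  have hT : ∀ n, T (n + 1) = next n (T n) := fun n => rfl
  have hanti : ∀ x, Antitone fun n => (T n).1 x := fun x =>
    antitone_nat_of_succ_le fun n => by rw [hT]; exact (hnext n (T n) x).1
  have hball : ∀ n x, (T (n + 1)).1 x ⊆ Metric.closedBall (c n (T n) x) ((1 / 2 : ℝ) ^ n) :=
    fun n x => by rw [hT]; exact (hnext n (T n) x).2
  have hpow : Tendsto (fun n : ℕ => (1 / 2 : ℝ) ^ n) atTop (𝓝 0) :=
    tendsto_pow_atTop_nhds_zero_of_lt_one (by norm_num) (by norm_num)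
  -- It is `T (n + 1)`, not `T n`, that has radius `(1 / 2) ^ n`, hence the shift of the index.
  have hlim : ∀ x, ∃ y, ∀ n, y ∈ (T n).1 x := fun x => by
    choose z hz using fun n => (T n).2.nonempty x
    have hcau : CauchySeq fun n => z (n + 1) := by
      refine cauchySeq_of_le_tendsto_0 (fun n => 2 * (1 / 2 : ℝ) ^ n) (fun i j N hi hj => ?_)
        (by simpa using hpow.const_mul 2)
      have h1 := hball N x (hanti x (by lia : N + 1 ≤ i + 1) (hz (i + 1)))
      have h2 := hball N x (hanti x (by lia : N + 1 ≤ j + 1) (hz (j + 1)))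
      rw [Metric.mem_closedBall] at h1 h2
      have := dist_triangle_right (z (i + 1)) (z (j + 1)) (c N (T N) x)
      linarith
    obtain ⟨y, hy⟩ := cauchySeq_tendsto_of_complete hcau
    refine ⟨y, fun n => ((T n).2.isClosed x).mem_of_tendsto hy ?_⟩
    filter_upwards [eventually_ge_atTop n] with i hi
    exact hanti x (by lia : n ≤ i + 1) (hz (i + 1))
  choose s hs using hlim
  refine ⟨s, ?_, fun x => hs x 0⟩
  refine measurable_of_tendsto_metrizable (f := fun n => c n (T n)) (fun n => hc n _) ?_
  rw [tendsto_pi_nhds]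
  intro x
  rw [tendsto_iff_dist_tendsto_zero]
  refine squeeze_zero (fun _ => dist_nonneg) (fun n => ?_) hpow
  rw [dist_comm]
  exact hball n x (hs x (n + 1))

end Selection

/-! ### Subgradients on the unit interval. -/

section Segment

/-- A function on `[0, 1]` with a continuous selection `p` of subgradients has derivative `p`. -/
theorem hasDerivWithinAt_of_subgradient {φ p : ℝ → ℝ} (hp : ContinuousOn p (Set.Icc 0 1))
    (hφ : ∀ s ∈ Set.Icc (0 : ℝ) 1, ∀ t ∈ Set.Icc (0 : ℝ) 1, φ t + (s - t) * p t ≤ φ s)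
    {t : ℝ} (ht : t ∈ Set.Icc (0 : ℝ) 1) : HasDerivWithinAt φ (p t) (Set.Icc 0 1) t := by
  rw [hasDerivWithinAt_iff_isLittleO, Asymptotics.isLittleO_iff]
  intro ε hε
  have h1 := Metric.continuousWithinAt_iff'.1 (hp t ht) ε hε
  filter_upwards [h1, self_mem_nhdsWithin] with s hs hsI
  rw [Real.dist_eq] at hs
  have h2 := hφ s hsI t ht
  have h3 := hφ t ht s hsI
  -- The two subgradient inequalities enclose the remainder between 0 and `(s - t) * (p s - p t)`.
  have h4 : |φ s - φ t - (s - t) * p t| ≤ |s - t| * |p s - p t| := by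
    rw [abs_of_nonneg (by linarith), ← abs_mul]
    refine le_trans ?_ (le_abs_self _)
    linarith
  simp only [smul_eq_mul, Real.norm_eq_abs]
  refine h4.trans ?_
  rw [mul_comm]
  exact mul_le_mul_of_nonneg_right hs.le (abs_nonneg _)

theorem tendsto_and_integral_of_subgradient {φ p : ℝ → ℝ} (hp : ContinuousOn p (Set.Icc 0 1))
    (hφ : ∀ s ∈ Set.Icc (0 : ℝ) 1, ∀ t ∈ Set.Icc (0 : ℝ) 1, φ t + (s - t) * p t ≤ φ s) :
    Tendsto (fun t : ℝ => (φ t - φ 0) / t) (𝓝[>] 0) (𝓝 (p 0)) ∧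
      IntervalIntegrable p volume 0 1 ∧ φ 1 - φ 0 = ∫ t in (0 : ℝ)..1, p t := by
  have hd := fun t ht => hasDerivWithinAt_of_subgradient hp hφ (t := t) ht
  have hint : IntervalIntegrable p volume 0 1 :=
    ContinuousOn.intervalIntegrable (by rwa [Set.uIcc_of_le zero_le_one])
  refine ⟨?_, hint, ?_⟩
  · have h0 := ((hd 0 (by simp)).mono Set.Ioo_subset_Icc_self).Ioi_of_Ioo zero_lt_one
    rw [hasDerivWithinAt_iff_tendsto_slope' (by simp)] at h0
    refine h0.congr fun t => ?_
    rw [slope_def_field, sub_zero]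
  · exact (intervalIntegral.integral_eq_sub_of_hasDerivAt_of_le zero_le_one
      (fun t ht => (hd t ht).continuousWithinAt)
      (fun t ht => (hd t (Set.Ioo_subset_Icc_self ht)).hasDerivAt (Icc_mem_nhds ht.1 ht.2))
      hint).symm

end Segment

/-! ### Bounds and regularity of $u_\lambda$; projections of the graph. -/

section Dual

variable {X Y H : Type*} [NormedAddCommGroup H] [InnerProductSpace ℝ H]
  {F : X → Set Y} {g : Graph F → H} {M : ℝ}

theorem abs_gLam_le (hM : ∀ z, ‖g z‖ ≤ M) (lam : H) (z : Graph F) :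
    |gLam g lam z| ≤ ‖lam‖ * M :=
  (abs_real_inner_le_norm _ _).trans (mul_le_mul_of_nonneg_left (hM z) (norm_nonneg _))

theorem u_le_gLam (hM : ∀ z, ‖g z‖ ≤ M) (lam : H) (z : Graph F) : u g lam z.1.1 ≤ gLam g lam z :=
  ciInf_le (f := fun y : F z.1.1 => gLam g lam (Graph.mk z.1.1 y.1 y.2))
    ⟨-(‖lam‖ * M), by rintro _ ⟨y, rfl⟩; exact (abs_le.1 (abs_gLam_le hM lam _)).1⟩ ⟨z.1.2, z.2⟩

/-- Non-emptiness matters: a real infimum over an empty fibre would be 0 by default. -/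
theorem le_u (hne : ∀ x, (F x).Nonempty) {lam : H} {x : X} {a : ℝ}
    (h : ∀ y (hy : y ∈ F x), a ≤ gLam g lam (Graph.mk x y hy)) : a ≤ u g lam x :=
  have := (hne x).to_subtype
  le_ciInf fun y => h y.1 y.2

theorem abs_u_le (hM : ∀ z, ‖g z‖ ≤ M) (hne : ∀ x, (F x).Nonempty) (lam : H) (x : X) :
    |u g lam x| ≤ ‖lam‖ * M := by
  obtain ⟨y, hy⟩ := hne x
  refine abs_le.2 ⟨le_u hne fun y hy => (abs_le.1 (abs_gLam_le hM lam _)).1, ?_⟩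
  exact (u_le_gLam hM lam (Graph.mk x y hy)).trans (abs_le.1 (abs_gLam_le hM lam _)).2

theorem abs_u_sub_u_le (hM : ∀ z, ‖g z‖ ≤ M) (hne : ∀ x, (F x).Nonempty) (lam lam' : H) (x : X) :
    |u g lam x - u g lam' x| ≤ ‖lam - lam'‖ * M := by
  have key : ∀ l l' : H, u g l x - ‖l - l'‖ * M ≤ u g l' x := fun l l' =>
    le_u hne fun y hy => by
      have h1 := u_le_gLam hM l (Graph.mk x y hy)
      have h2 := (abs_le.1 (abs_gLam_le hM (l - l') (Graph.mk x y hy))).2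
      have h3 : gLam g (l - l') (Graph.mk x y hy) =
        gLam g l (Graph.mk x y hy) - gLam g l' (Graph.mk x y hy) := inner_sub_left _ _ _
      dsimp only at h1
      linarith
  have h1 := key lam lam'
  have h2 := key lam' lam
  rw [norm_sub_rev] at h2
  exact abs_le.2 ⟨by linarith, by linarith⟩

/-- A Lipschitz image set transfers its modulus, times `‖lam‖`, to the infimum of a linear form on
it. -/
theorem continuous_u [MetricSpace X] (hM : ∀ z, ‖g z‖ ≤ M) (hne : ∀ x, (F x).Nonempty) {Lg : ℝ≥0}
    (hl : LipschitzSetValued Lg (gImage g)) (lam : H) : Continuous (u g lam) := by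
  refine (LipschitzWith.of_le_add_mul (‖lam‖₊ * Lg) fun x₁ x₂ => ?_).continuous
  rw [← sub_le_iff_le_add]
  refine le_u hne fun y hy => ?_
  obtain ⟨_, ⟨y', rfl⟩, w, hw, hsum⟩ := hl x₂ x₁ ⟨⟨y, hy⟩, rfl⟩
  have h1 := u_le_gLam hM lam (Graph.mk x₁ y'.1 y'.2)
  have h2 : gLam g lam (Graph.mk x₂ y hy) = gLam g lam (Graph.mk x₁ y'.1 y'.2) + inner ℝ lam w := by
    simp only [gLam]
    rw [← inner_add_right]
    exact congrArg _ hsum.symm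
  have h3 : -(‖lam‖ * (Lg * dist x₁ x₂)) ≤ inner ℝ lam w := by
    refine (abs_le.1 ((abs_real_inner_le_norm lam w).trans
      (mul_le_mul_of_nonneg_left ?_ (norm_nonneg _)))).1
    rw [dist_comm]
    simpa using hw
  dsimp only at h1
  push_cast
  rw [mul_assoc]
  linarith

/-- The projection of the graph of an upper hemicontinuous compact-valued map is closed. -/
theorem isClosed_image_fst [TopologicalSpace X] [TopologicalSpace Y]
    (hF : UpperHemicontinuous F) (hc : ∀ x, IsCompact (F x)) (hcl : IsClosed (Graph F))
    {W : Set (Graph F)} (hW : IsClosed W) : IsClosed ((fun z : Graph F => z.1.1) '' W) := by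
  have hW' : IsClosed (Subtype.val '' W : Set (X × Y)) :=
    hcl.isClosedEmbedding_subtypeVal.isClosedMap _ hW
  rw [← isOpen_compl_iff, isOpen_iff_mem_nhds]
  intro x hx
  have hsub : ({x} : Set X) ×ˢ F x ⊆ (Subtype.val '' W)ᶜ := by
    rintro ⟨x', y⟩ ⟨rfl, hy⟩ ⟨z, hz, hzx⟩
    exact hx ⟨z, hz, congrArg Prod.fst hzx⟩
  -- The tube lemma separates the compact fibre from `W`; upper hemicontinuity keeps nearby fibres
  -- inside `O`.
  obtain ⟨U, O, hU, hO, hxU, hFO, hUO⟩ :=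
    generalized_tube_lemma isCompact_singleton (hc x) hW'.isOpen_compl hsub
  filter_upwards [hU.mem_nhds (hxU rfl), hF.forall_isOpen x O hO hFO] with x' hx' hFx'
  rintro ⟨z, hz, rfl⟩
  exact hUO (Set.mk_mem_prod hx' (hFx' z.2)) ⟨z, hz, rfl⟩

theorem integrable_u [MetricSpace X] [MeasurableSpace X] [BorelSpace X]
    (hM : ∀ z, ‖g z‖ ≤ M) (hne : ∀ x, (F x).Nonempty) {Lg : ℝ≥0}
    (hl : LipschitzSetValued Lg (gImage g)) (lam : H) (m : Measure X) [IsFiniteMeasure m] :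
    Integrable (u g lam) m :=
  .of_bound (continuous_u hM hne hl lam).aestronglyMeasurable (‖lam‖ * M)
    (Eventually.of_forall fun x => abs_u_le hM hne lam x)

theorem measurable_graph_fst [MeasurableSpace X] [MeasurableSpace Y] :
    Measurable fun z : Graph F => z.1.1 :=
  measurable_fst.comp measurable_subtype_coe

theorem norm_le_of_mem_aggregates [MeasurableSpace X] [MeasurableSpace Y]
    (hM : ∀ z, ‖g z‖ ≤ M) {m : Measure X} {β : H} (hβ : β ∈ aggregates g m) : ‖β‖ ≤ M := by
  obtain ⟨μ, ⟨hμ, -⟩, rfl⟩ := hβ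
  simpa using norm_integral_le_of_norm_le_const (μ := μ) (Eventually.of_forall hM)

end Dual

theorem integrable_g {X Y H : Type*} [TopologicalSpace X] [SecondCountableTopology X]
    [MeasurableSpace X] [BorelSpace X] [TopologicalSpace Y] [SecondCountableTopology Y]
    [MeasurableSpace Y] [BorelSpace Y] [NormedAddCommGroup H] {F : X → Set Y} {g : Graph F → H}
    {M : ℝ} (hM : ∀ z, ‖g z‖ ≤ M) (hg : Continuous g) (μ : Measure (Graph F))
    [IsFiniteMeasure μ] : Integrable g μ :=
  .of_bound hg.aestronglyMeasurable M (Eventually.of_forall hM)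

/-! ### Linear minimization over the aggregates. -/

section Measures

variable {X Y H : Type*} [MetricSpace X] [SecondCountableTopology X] [MeasurableSpace X]
  [BorelSpace X] [MetricSpace Y] [MeasurableSpace Y] [BorelSpace Y]
  [NormedAddCommGroup H] [InnerProductSpace ℝ H]
  {F : X → Set Y} {g : Graph F → H} {M : ℝ}

theorem integral_u_le [SecondCountableTopology Y] [CompleteSpace H]
    (hM : ∀ z, ‖g z‖ ≤ M) (hne : ∀ x, (F x).Nonempty)
    {Lg : ℝ≥0} (hB : StabilityAssumption F g Lg) (lam : H) {m : Measure X}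
    {β : H} (hβ : β ∈ aggregates g m) : ∫ x, u g lam x ∂m ≤ inner ℝ lam β := by
  obtain ⟨μ, ⟨hμ, rfl⟩, rfl⟩ := hβ
  have hu := continuous_u hM hne hB.lipschitz_gImage lam
  have hi := integrable_g hM hB.continuous_g μ
  have hmap : IsProbabilityMeasure (μ.map fun z : Graph F => z.1.1) :=
    Measure.isProbabilityMeasure_map measurable_graph_fst.aemeasurable
  have hiu := (integrable_map_measure hu.aestronglyMeasurable measurable_graph_fst.aemeasurable).1
    (integrable_u hM hne hB.lipschitz_gImage lam (μ.map fun z : Graph F => z.1.1))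
  dsimp only
  rw [integral_map measurable_graph_fst.aemeasurable hu.aestronglyMeasurable,
    ← integral_inner hi lam]
  exact integral_mono hiu (hi.const_inner lam) fun z => u_le_gLam hM lam z

/-- Push `m` forward along $x\mapsto(x,s(x))$, with `s` a measurable selection of minimizers.
Together with `integral_u_le`, this identifies the support function of the aggregates. -/
theorem exists_aggregate_inner_le [CompleteSpace Y] [SecondCountableTopology Y] [CompleteSpace H]
    (hM : ∀ z, ‖g z‖ ≤ M) (hne : ∀ x, (F x).Nonempty) (hcl : IsClosed (Graph F))
    {Lg : ℝ≥0} (hB : StabilityAssumption F g Lg) (lam : H) (m : Measure X)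
    [IsProbabilityMeasure m] : ∃ β ∈ aggregates g m, inner ℝ lam β = ∫ x, u g lam x ∂m := by
  have hu := continuous_u hM hne hB.lipschitz_gImage lam
  have hgl : Continuous (gLam g lam) := continuous_const.inner hB.continuous_g
  have hmk : ∀ x, Continuous fun y : F x => (Graph.mk x y.1 y.2 : Graph F) := fun x => by
    fun_prop
  let S : X → Set Y := fun x => {y | ∃ hy : y ∈ F x, gLam g lam (Graph.mk x y hy) ≤ u g lam x}
  have hS : MeasurableClosedValued S := by
    refine ⟨fun x => ?_, fun x => ?_, fun C hC => ?_⟩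
    · have := (hne x).to_subtype
      have := isCompact_iff_compactSpace.1 (hB.compact_fibres x)
      obtain ⟨y, -, hy⟩ := isCompact_univ.exists_isMinOn Set.univ_nonempty
        (hgl.comp (hmk x)).continuousOn
      exact ⟨y.1, y.2, le_u hne fun y' hy' => hy (Set.mem_univ (⟨y', hy'⟩ : F x))⟩
    · have : S x = Subtype.val '' {y : F x | gLam g lam (Graph.mk x y.1 y.2) ≤ u g lam x} := by
        ext y; simp [S]
      rw [this]
      exact (hB.compact_fibres x).isClosed.isClosedEmbedding_subtypeVal.isClosedMap _
        (isClosed_le (hgl.comp (hmk x)) continuous_const)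
    -- As a projection of a closed subset of the graph, this set is itself closed.
    · have : {x | (S x ∩ C).Nonempty} = (fun z : Graph F => z.1.1) ''
          {z | gLam g lam z ≤ u g lam z.1.1 ∧ z.1.2 ∈ C} := by
        ext x
        constructor
        · rintro ⟨y, ⟨hy, h⟩, hC⟩
          exact ⟨Graph.mk x y hy, ⟨h, hC⟩, rfl⟩
        · rintro ⟨z, ⟨h, hC⟩, rfl⟩
          exact ⟨z.1.2, ⟨z.2, h⟩, hC⟩
      rw [this]
      refine (isClosed_image_fst hB.usc_F hB.compact_fibres hcl
        (IsClosed.inter ?_ ?_)).measurableSet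
      · exact isClosed_le hgl (hu.comp (by fun_prop))
      · exact hC.preimage (by fun_prop)
  obtain ⟨s, hs, hsS⟩ := hS.exists_measurable_selection
  let r : X → Graph F := fun x => Graph.mk x (s x) (hsS x).1
  have hr : Measurable r := (measurable_id.prodMk hs).subtype_mk
  have hprob : IsProbabilityMeasure (m.map r) := Measure.isProbabilityMeasure_map hr.aemeasurable
  refine ⟨∫ z, g z ∂(m.map r), ⟨m.map r, ⟨hprob, ?_⟩, rfl⟩, ?_⟩
  · rw [Measure.map_map measurable_graph_fst hr]
    exact Measure.map_id
  · rw [← integral_inner (integrable_g hM hB.continuous_g _) lam,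
      integral_map hr.aemeasurable (continuous_const.inner hB.continuous_g).aestronglyMeasurable]
    refine integral_congr_ae (Eventually.of_forall fun x => ?_)
    exact le_antisymm (hsS x).2 (u_le_gLam hM lam (r x))

theorem convex_aggregates [SecondCountableTopology Y] (hM : ∀ z, ‖g z‖ ≤ M) (hg : Continuous g)
    (m : Measure X) : Convex ℝ (aggregates g m) := by
  rintro _ ⟨μ, ⟨hμ, hμm⟩, rfl⟩ _ ⟨ν, ⟨hν, hνm⟩, rfl⟩ a b ha hb hab
  have hab' : ENNReal.ofReal a + ENNReal.ofReal b = 1 := by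
    rw [← ENNReal.ofReal_add ha hb, hab, ENNReal.ofReal_one]
  refine ⟨ENNReal.ofReal a • μ + ENNReal.ofReal b • ν, ⟨⟨by simp [hab']⟩, ?_⟩, ?_⟩
  · rw [Measure.map_add _ _ measurable_graph_fst, Measure.map_smul, Measure.map_smul, hμm, hνm,
      ← add_smul, hab', one_smul]
  · dsimp only
    rw [integral_add_measure ((integrable_g hM hg μ).smul_measure ENNReal.ofReal_ne_top)
      ((integrable_g hM hg ν).smul_measure ENNReal.ofReal_ne_top), integral_smul_measure,
      integral_smul_measure, ENNReal.toReal_ofReal ha, ENNReal.toReal_ofReal hb]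

end Measures

/-! ### Segments of measures. -/

section Segment

variable {X : Type*} [MeasurableSpace X]

theorem integral_segment {m₀ m₁ : Measure X} {φ : X → ℝ} (h₀ : Integrable φ m₀)
    (h₁ : Integrable φ m₁) {t : ℝ} (ht : t ∈ Set.Icc (0 : ℝ) 1) :
    ∫ x, φ x ∂(segment m₀ m₁ t) = ∫ x, φ x ∂m₀ + t * integralDiff φ m₀ m₁ := by
  rw [segment, integral_add_measure (h₀.smul_measure ENNReal.ofReal_ne_top)
    (h₁.smul_measure ENNReal.ofReal_ne_top), integral_smul_measure, integral_smul_measure,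
    ENNReal.toReal_ofReal (sub_nonneg.2 ht.2), ENNReal.toReal_ofReal ht.1, integralDiff]
  simp only [smul_eq_mul]
  ring

theorem segment_zero (m₀ m₁ : Measure X) : segment m₀ m₁ 0 = m₀ := by simp [segment]

theorem segment_one (m₀ m₁ : Measure X) : segment m₀ m₁ 1 = m₁ := by simp [segment]

theorem segment_mem_P1 [MetricSpace X] {m₀ m₁ : Measure X} (h₀ : m₀ ∈ P1 X) (h₁ : m₁ ∈ P1 X)
    {t : ℝ} (ht : t ∈ Set.Icc (0 : ℝ) 1) : segment m₀ m₁ t ∈ P1 X := by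
  obtain ⟨hp₀, x₀, hx₀⟩ := h₀
  obtain ⟨hp₁, x₁, hx₁⟩ := h₁
  have hx : ∫⁻ x, edist x x₀ ∂m₁ < ∞ := by
    calc ∫⁻ x, edist x x₀ ∂m₁ ≤ ∫⁻ x, edist x x₁ + edist x₁ x₀ ∂m₁ :=
          lintegral_mono fun x => edist_triangle _ _ _
      _ = ∫⁻ x, edist x x₁ ∂m₁ + edist x₁ x₀ := by
          rw [lintegral_add_right _ measurable_const]; simp
      _ < ∞ := ENNReal.add_lt_top.2 ⟨hx₁, edist_lt_top _ _⟩
  refine ⟨⟨?_⟩, x₀, ?_⟩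
  · simp [segment, ← ENNReal.ofReal_add (sub_nonneg.2 ht.2) ht.1]
  · rw [segment, lintegral_add_measure, lintegral_smul_measure, lintegral_smul_measure]
    exact ENNReal.add_lt_top.2 ⟨ENNReal.mul_lt_top ENNReal.ofReal_lt_top hx₀,
      ENNReal.mul_lt_top ENNReal.ofReal_lt_top hx⟩

end Segment

theorem abs_integralDiff_u_sub_le {X Y H : Type*} [MetricSpace X] [MeasurableSpace X]
    [BorelSpace X] [NormedAddCommGroup H] [InnerProductSpace ℝ H] {F : X → Set Y}
    {g : Graph F → H} {Lg : ℝ≥0} {M : ℝ} (hM : ∀ z, ‖g z‖ ≤ M)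
    (hne : ∀ x, (F x).Nonempty) (hl : LipschitzSetValued Lg (gImage g)) (lam lam' : H)
    (m₀ m₁ : Measure X) [IsProbabilityMeasure m₀] [IsProbabilityMeasure m₁] :
    |integralDiff (u g lam) m₀ m₁ - integralDiff (u g lam') m₀ m₁| ≤ 2 * M * ‖lam - lam'‖ := by
  have key : ∀ (m : Measure X) [IsProbabilityMeasure m],
      |∫ x, u g lam x ∂m - ∫ x, u g lam' x ∂m| ≤ ‖lam - lam'‖ * M := fun m _ => by
    rw [← integral_sub (integrable_u hM hne hl lam m) (integrable_u hM hne hl lam' m)]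
    simpa using norm_integral_le_of_norm_le_const (μ := m)
      (f := fun x => u g lam x - u g lam' x) (Eventually.of_forall fun x =>
        abs_u_sub_u_le hM hne lam lam' x)
  have h0 := abs_le.1 (key m₀)
  have h1 := abs_le.1 (key m₁)
  simp only [integralDiff]
  exact abs_le.2 ⟨by linarith [h0.2, h1.1], by linarith [h0.1, h1.2]⟩

/-! ### Strong duality and uniqueness of the dual solution. -/

section Duality

variable {X Y H : Type*} [MetricSpace X] [SecondCountableTopology X] [MeasurableSpace X]
  [BorelSpace X] [MetricSpace Y] [CompleteSpace Y] [SecondCountableTopology Y] [MeasurableSpace Y]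
  [BorelSpace Y] [NormedAddCommGroup H] [InnerProductSpace ℝ H] [CompleteSpace H]
  {F : X → Set Y} {f : H → ℝ} {g : Graph F → H} {L Lg : ℝ≥0}

/-- Strong duality: the dual solution is the gradient of `f` at an optimal aggregate. -/
theorem exists_optimal_aggregate (hA : DualityAssumption f g L) (hB : StabilityAssumption F g Lg)
    (hcl : IsClosed (Graph F)) (hne : ∀ x, (F x).Nonempty) (m : Measure X)
    [IsProbabilityMeasure m] (hG : IsClosed (aggregates g m)) :
    ∃ β ∈ aggregates g m, IsLeast (costs f g m) (f β) ∧
      inner ℝ (gradient f β) β = ∫ x, u g (gradient f β) x ∂m ∧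
      ∀ lam, IsDualSolution f g m lam ↔ lam = gradient f β := by
  obtain ⟨M, hM⟩ := hA.bounded_g
  have hgrad := add_inner_gradient_le hA.convex_f hA.differentiable_f
  have hconv := convex_aggregates hM hB.continuous_g m
  have hbdd : BddBelow (f '' aggregates g m) := by
    refine ⟨f 0 - ‖gradient f 0‖ * M, ?_⟩
    rintro _ ⟨β, hβ, rfl⟩
    have h1 := hgrad 0 β
    have h2 := (abs_le.1 ((abs_real_inner_le_norm (gradient f 0) β).trans
      (mul_le_mul_of_nonneg_left (norm_le_of_mem_aggregates hM hβ) (norm_nonneg _)))).1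
    rw [sub_zero] at h1
    linarith
  -- The direction 0 is arbitrary: only non-emptiness is needed.
  obtain ⟨β₀, hβ₀, -⟩ := exists_aggregate_inner_le hM hne hcl hB 0 m
  obtain ⟨β, hβ, hmin⟩ := exists_isMinOn_of_convex hA.convex_f hA.differentiable_f.continuous
    ⟨β₀, hβ₀⟩ hG hconv (fun _ h => norm_le_of_mem_aggregates hM h) hbdd
  have hfirst : ∀ b ∈ aggregates g m, inner ℝ (gradient f β) β ≤ inner ℝ (gradient f β) b :=
    fun b hb => by
      have h := le_inner_gradient hA.differentiable_f (x := β) (d := b - β) (c := 0) fun t ht => by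
        have h1 := hmin (hconv.add_smul_sub_mem hβ hb ⟨ht.1.le, ht.2.le⟩)
        rw [zero_mul]
        exact sub_nonneg.2 h1
      rw [inner_sub_right] at h
      linarith
  obtain ⟨b, hb, hbe⟩ := exists_aggregate_inner_le hM hne hcl hB (gradient f β) m
  have heq : inner ℝ (gradient f β) β = ∫ x, u g (gradient f β) x ∂m :=
    le_antisymm (hbe ▸ hfirst b hb) (integral_u_le hM hne hB _ hβ)
  have hconj : fenchelConj f (gradient f β) ≤ ((inner ℝ (gradient f β) β - f β : ℝ) : EReal) :=
    iSup_le fun y => EReal.coe_le_coe_iff.2 (by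
      have := hgrad β y
      rw [inner_sub_right] at this
      linarith)
  have hdual : dualObj f g m (gradient f β) ≤ ((-f β : ℝ) : EReal) := by
    refine (EReal.sub_le_sub hconj le_rfl).trans ?_
    rw [← heq, ← EReal.coe_sub]
    exact EReal.coe_le_coe_iff.2 (by linarith)
  have hlow : ∀ lam y : H,
      ((inner ℝ lam y - f y - ∫ x, u g lam x ∂m : ℝ) : EReal) ≤ dualObj f g m lam :=
    fun lam y => by
      rw [EReal.coe_sub]
      exact EReal.sub_le_sub
        (le_iSup (fun y : H => ((inner ℝ lam y - f y : ℝ) : EReal)) y) le_rfl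
  refine ⟨β, hβ, ⟨?_, ?_⟩, heq, fun lam => ⟨fun h => ?_, ?_⟩⟩
  · obtain ⟨μ, hμ, rfl⟩ := hβ
    exact ⟨μ, hμ, rfl⟩
  · rintro _ ⟨μ, hμ, rfl⟩
    exact hmin ⟨μ, hμ, rfl⟩
  -- Optimality gives `inner ℝ lam y - f y - ∫ u ≤ -f β` for every `y`; since `∫ u ≤ inner ℝ lam β`,
  -- `lam` is a subgradient at `β`.
  · refine eq_gradient_of_subgradient hA.differentiable_f fun y => ?_
    have h1 := EReal.coe_le_coe_iff.1 ((hlow lam y).trans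
      ((h.2 (hconj.trans_lt (EReal.coe_lt_top _))).trans hdual))
    have h2 := integral_u_le hM hne hB lam hβ
    rw [inner_sub_right]
    linarith
  · rintro rfl
    refine ⟨hconj.trans_lt (EReal.coe_lt_top _), fun lam _ => ?_⟩
    refine hdual.trans (le_trans (EReal.coe_le_coe_iff.2 ?_) (hlow lam β))
    have := integral_u_le hM hne hB lam hβ
    linarith

end Duality

end MFO

/-! ### Differentiability of the value function. -/

theorem mainTheorem6
    {E : Type*} [NormedAddCommGroup E] [NormedSpace ℝ E] [CompleteSpace E]
    [TopologicalSpace.SeparableSpace E] [MeasurableSpace E] [BorelSpace E]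
    (X : Set E) (hX : IsClosed X)
    {Y : Type*} [MetricSpace Y] [CompleteSpace Y] [TopologicalSpace.SeparableSpace Y]
    [MeasurableSpace Y] [BorelSpace Y]
    {H : Type*} [NormedAddCommGroup H] [InnerProductSpace ℝ H] [CompleteSpace H]
    [TopologicalSpace.SeparableSpace H]
    (F : X → Set Y) (hF_closed : IsClosed (MFO.Graph F)) (hF_nonempty : ∀ x, (F x).Nonempty)
    (f : H → ℝ) (g : MFO.Graph F → H) (L Lg : ℝ≥0)
    (hA : MFO.DualityAssumption f g L) (hB : MFO.StabilityAssumption F g Lg)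
    (hG : ∀ m ∈ MFO.P1 X, IsClosed (MFO.aggregates g m)) :
    (∀ m ∈ MFO.P1 X, IsGLB (MFO.costs f g m) (MFO.V f g m)) ∧
    (∀ m ∈ MFO.P1 X, ∃! lam : H, MFO.IsDualSolution f g m lam) ∧
    (∀ m ∈ MFO.P1 X, ∀ m' ∈ MFO.P1 X, Integrable (MFO.v f g m) m') ∧
    ∀ m₀ ∈ MFO.P1 X, ∀ m₁ ∈ MFO.P1 X,
      Tendsto (fun t : ℝ => (MFO.V f g (MFO.segment m₀ m₁ t) - MFO.V f g m₀) / t)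
        (𝓝[>] 0) (𝓝 (MFO.integralDiff (MFO.v f g m₀) m₀ m₁)) ∧
      IntervalIntegrable
        (fun t : ℝ => MFO.integralDiff (MFO.v f g (MFO.segment m₀ m₁ t)) m₀ m₁) volume 0 1 ∧
      MFO.V f g m₁ - MFO.V f g m₀ =
        ∫ t in (0 : ℝ)..1, MFO.integralDiff (MFO.v f g (MFO.segment m₀ m₁ t)) m₀ m₁ := by
  have : SecondCountableTopology E := UniformSpace.secondCountable_of_separable E
  have : SecondCountableTopology Y := UniformSpace.secondCountable_of_separable Y
  obtain ⟨M, hM⟩ := hA.bounded_g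
  have hopt : ∀ m ∈ MFO.P1 X, ∃ β ∈ MFO.aggregates g m, IsLeast (MFO.costs f g m) (f β) ∧
      inner ℝ (gradient f β) β = ∫ x, MFO.u g (gradient f β) x ∂m ∧
      ∀ lam, MFO.IsDualSolution f g m lam ↔ lam = gradient f β := fun m hm =>
    have := hm.1
    MFO.exists_optimal_aggregate hA hB hF_closed hF_nonempty m (hG m hm)
  choose! β hβ hleast heq hsol using hopt
  have hint : ∀ lam, ∀ m ∈ MFO.P1 X, Integrable (MFO.u g lam) m := fun lam m hm =>
    have := hm.1
    MFO.integrable_u hM hF_nonempty hB.lipschitz_gImage lam m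
  have hV : ∀ m ∈ MFO.P1 X, MFO.V f g m = f (β m) := fun m hm => (hleast m hm).csInf_eq
  have hlam : ∀ m ∈ MFO.P1 X, MFO.dualSolution f g m = gradient f (β m) := fun m hm =>
    (hsol m hm _).1 (Classical.epsilon_spec ⟨_, (hsol m hm _).2 rfl⟩)
  have hv : ∀ m ∈ MFO.P1 X, MFO.v f g m = MFO.u g (gradient f (β m)) := fun m hm => by
    funext x
    rw [MFO.v, hlam m hm]
  refine ⟨fun m hm => hV m hm ▸ (hleast m hm).isGLB,
    fun m hm => ⟨_, (hsol m hm _).2 rfl, fun lam h => (hsol m hm lam).1 h⟩,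
    fun m hm m' hm' => hv m hm ▸ hint _ m' hm', fun m₀ hm₀ m₁ hm₁ => ?_⟩
  have := hm₀.1
  have := hm₁.1
  have hseg : ∀ t ∈ Set.Icc (0 : ℝ) 1, MFO.segment m₀ m₁ t ∈ MFO.P1 X := fun t ht =>
    MFO.segment_mem_P1 hm₀ hm₁ ht
  let lam : ℝ → H := fun t => gradient f (β (MFO.segment m₀ m₁ t))
  let φ : ℝ → ℝ := fun t => MFO.V f g (MFO.segment m₀ m₁ t)
  let p : ℝ → ℝ := fun t => MFO.integralDiff (MFO.v f g (MFO.segment m₀ m₁ t)) m₀ m₁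
  have hp : ∀ t ∈ Set.Icc (0 : ℝ) 1, p t = MFO.integralDiff (MFO.u g (lam t)) m₀ m₁ :=
    fun t ht => by simp only [p, lam, hv _ (hseg t ht)]
  -- `L` may be 0, whereas the quantitative inequality divides by the constant.
  have hK : (0 : ℝ) < L + 1 := by positivity
  have hgrad := MFO.add_inner_gradient_add_norm_sq_le hA.convex_f hA.differentiable_f hK
    fun x y => (hA.lipschitz_gradient.norm_sub_le x y).trans
      (mul_le_mul_of_nonneg_right (by simp) (norm_nonneg _))
  -- `lam t` pairs with the optimal aggregate at `s` to at least $\int u_{\lambda_t}\,dm_s$, with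
  -- equality at `s = t`; the two integrals differ by `(s - t) * p t`.
  have hφ : ∀ s ∈ Set.Icc (0 : ℝ) 1, ∀ t ∈ Set.Icc (0 : ℝ) 1,
      φ t + (s - t) * p t + (4 * ((L : ℝ) + 1))⁻¹ * ‖lam s - lam t‖ ^ 2 ≤ φ s :=
    fun s hs t ht => by
      have h1 := hgrad (β (MFO.segment m₀ m₁ t)) (β (MFO.segment m₀ m₁ s))
      have h2 := MFO.integral_u_le hM hF_nonempty hB (lam t) (hβ _ (hseg s hs))
      have h3 := heq _ (hseg t ht)
      rw [MFO.integral_segment (hint _ m₀ hm₀) (hint _ m₁ hm₁) hs, ← hp t ht] at h2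
      rw [MFO.integral_segment (hint _ m₀ hm₀) (hint _ m₁ hm₁) ht] at h3
      change _ = _ + t * MFO.integralDiff (MFO.u g (lam t)) m₀ m₁ at h3
      rw [← hp t ht] at h3
      rw [inner_sub_right] at h1
      simp only [φ, hV _ (hseg s hs), hV _ (hseg t ht)]
      simp only [lam] at h2 h3 ⊢
      linarith
  have hplip : ∀ s ∈ Set.Icc (0 : ℝ) 1, ∀ t ∈ Set.Icc (0 : ℝ) 1,
      |p s - p t| ≤ 2 * M * ‖lam s - lam t‖ := fun s hs t ht => by
    rw [hp s hs, hp t ht]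
    exact MFO.abs_integralDiff_u_sub_le hM hF_nonempty hB.lipschitz_gImage _ _ m₀ m₁
  have hM0 : 0 ≤ M := by
    obtain ⟨μ, ⟨hμ, -⟩, -⟩ := hβ m₀ hm₀
    exact (norm_nonneg _).trans (hM (nonempty_of_isProbabilityMeasure μ).some)
  have hlamlip : ∀ s ∈ Set.Icc (0 : ℝ) 1, ∀ t ∈ Set.Icc (0 : ℝ) 1,
      ‖lam s - lam t‖ ≤ 4 * (L + 1) * M * |s - t| := fun s hs t ht => by
    have h1 := hφ s hs t ht
    have h2 := hφ t ht s hs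
    rw [norm_sub_rev] at h2
    -- Adding `hφ` to its copy with `s` and `t` exchanged cancels `φ`. One factor `‖lam s - lam t‖`
    -- is then divided out.
    have h3 : 2 * (4 * ((L : ℝ) + 1))⁻¹ * ‖lam s - lam t‖ ^ 2 ≤
        |s - t| * (2 * M * ‖lam s - lam t‖) :=
      calc _ ≤ (s - t) * (p s - p t) := by linarith
        _ ≤ |s - t| * |p s - p t| := by rw [← abs_mul]; exact le_abs_self _
        _ ≤ _ := mul_le_mul_of_nonneg_left (hplip s hs t ht) (abs_nonneg _)
    rcases (norm_nonneg (lam s - lam t)).eq_or_lt with h0 | h0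
    · rw [← h0]; positivity
    · refine le_of_mul_le_mul_right ?_ h0
      have h4 : 2 * (4 * ((L : ℝ) + 1))⁻¹ * ‖lam s - lam t‖ ^ 2 * (2 * (L + 1)) =
          ‖lam s - lam t‖ * ‖lam s - lam t‖ := by field_simp; ring
      rw [← h4]
      calc _ ≤ |s - t| * (2 * M * ‖lam s - lam t‖) * (2 * (L + 1)) :=
            mul_le_mul_of_nonneg_right h3 (by positivity)
        _ = _ := by ring
  have hpcont : ContinuousOn p (Set.Icc 0 1) := by
    refine (LipschitzOnWith.of_dist_le_mul (K := ⟨2 * M * (4 * (L + 1) * M), by positivity⟩)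
      fun s hs t ht => ?_).continuousOn
    rw [Real.dist_eq, Real.dist_eq]
    refine (hplip s hs t ht).trans ?_
    change _ ≤ 2 * M * (4 * (L + 1) * M) * |s - t|
    rw [mul_assoc (2 * M)]
    exact mul_le_mul_of_nonneg_left (hlamlip s hs t ht) (by positivity)
  have hmain := MFO.tendsto_and_integral_of_subgradient hpcont (φ := φ) fun s hs t ht =>
    (le_add_of_nonneg_right (by positivity)).trans (hφ s hs t ht)
  simpa only [φ, p, MFO.segment_zero, MFO.segment_one] using hmain
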